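/- Let $k\ge 0$ be an integer. A subgroup $H$ of a group $G$ is called malnormal if $H\cap x^{-1}Hx=1$ for all $x\in G\setminus H$. A group $G$ is called $\mathrm{CSN}_k$ if every subgroup of $G$ that is maximal (with respect to inclusion) among the subgroups of $G$ which are nilpotent of class at most $k$ is malnormal in $G$. (1) If $A$ and $B$ are $\mathrm{CSN}_k$ groups without elements of order $2$, then the free product $A\ast B$ is $\mathrm{CSN}_k$. (2) Let $A$ be a finitely generated free object of the variety of groups that are nilpotent of class at most $k$, i.e. $A$ is a finitely generated group isomorphic to $F/\gamma_{k+1}(F)$ for a free group $F$, where $\gamma_{k+1}(F)$ is the $(k+1)$-st term of the lower central series ($\gamma_1(F)=F$). Then every $A$-free group, that is, every free product of a non-empty (possibly infinite) family of copies of $A$, is $\mathrm{CSN}_k$. -/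

import Mathlib

universe u v w x

/-- `G` is nilpotent of class at most `k`. -/
def IsNilpotentOfClassLE (k : ℕ) (G : Type u) [Group G] : Prop :=
  Group.IsNilpotent G ∧ Group.nilpotencyClass G ≤ k

/-- `H` is malnormal in `G`: for every `x ∈ G \ H` the subgroup `H` meets its conjugate
`H ^ x = x⁻¹ H x` trivially. -/
def Subgroup.IsMalnormal {G : Type u} [Group G] (H : Subgroup G) : Prop :=
  ∀ x : G, x ∉ H → H ⊓ H.map (MulAut.conj x⁻¹).toMonoidHom = ⊥

/-- `H` is maximal, with respect to inclusion, among the subgroups of `G` which are nilpotent of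
class at most `k`. -/
def Subgroup.IsMaximalNilpotentOfClassLE (k : ℕ) {G : Type u} [Group G] (H : Subgroup G) : Prop :=
  Maximal (fun K : Subgroup G => IsNilpotentOfClassLE k K) H

/-- `CSN_k` groups (conjugately separated nilpotent of class `k`). -/
def IsCSN (k : ℕ) (G : Type u) [Group G] : Prop :=
  ∀ H : Subgroup G, H.IsMaximalNilpotentOfClassLE k → H.IsMalnormal

/-- The free object on `X` in the variety of groups which are nilpotent of class at most `k`,
that is `F(X) / γ_{k+1}(F(X))`. In Mathlib the lower central series starts at index `0`, so
that the term of index `k` is `γ_{k+1}`. -/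
abbrev FreeNilpotentGroup (k : ℕ) (X : Type w) : Type w :=
  FreeGroup X ⧸ (⊤ : Subgroup (FreeGroup X)).lowerCentralSeries k

/-- `A` is a free object of the variety of groups which are nilpotent of class at most `k`. -/
def IsFreeNilpotent (k : ℕ) (A : Type u) [Group A] : Prop :=
  ∃ X : Type w, Nonempty (A ≃* FreeNilpotentGroup k X)

/-- `G` is the free product of a non-empty family of copies of `A`. -/
def IsFreeProductOfCopies (A : Type u) (G : Type v) [Group A] [Group G] : Prop :=
  ∃ ι : Type w, Nonempty ι ∧ Nonempty (G ≃* Monoid.CoprodI (fun _ : ι => A))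

/-! A maximal nilpotent subgroup `H ≠ 1` of a free product has a central element `z ≠ 1`, which up
to conjugacy lies in a factor or is cyclically reduced. In the first case the centralizer of `z`,
hence `H`, lies in that factor, and so does every element conjugating a nontrivial element of the
factor into the factor; malnormality is then inherited (`isMalnormal_of_mem_range`). In the second
case `H` fixes the end of the periodic infinite word `…zzz`. The stabilizer of this end embeds in
`ℤ` by measuring shifts, so it is abelian and equals `H` by maximality. If `x` conjugates a
nontrivial element of `H` into `H`, it conjugates a nonzero power of `z` to another. Equal signs of
the exponents force `x ∈ H`; opposite signs force `x` to have order two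
(`isMalnormal_of_cyclicallyReduced`).

For free nilpotent factors the `CSN_k` condition is trivial, so what remains is the absence of
elements of order two. This follows by eliminating letters (`weightedSeries_sq_of_eliminate`): with
weights on the letters, a free group modulo the `n`-th term of its weighted series embeds in an
extension of a similar quotient by `ℤ`. The new letters are the iterated commutators `[y, x, …, x]`,
and the weights grow until every letter lies in the `n`-th term and the quotient is trivial. -/

open scoped commutatorElement

/-! ### `N`-series and automorphisms that shift them -/

/-- An `N`-series of a group: a descending series starting at the whole group such that
`⁅H i, H j⁆ ≤ H (i + j)`. -/
structure IsNSeries {G : Type*} [Group G] (H : ℕ → Subgroup G) : Prop where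
  antitone : Antitone H
  zero : H 0 = ⊤
  commutator_le : ∀ i j, ⁅H i, H j⁆ ≤ H (i + j)

namespace IsNSeries

variable {G : Type*} [Group G] {H : ℕ → Subgroup G}

theorem normal (hH : IsNSeries H) (n : ℕ) : (H n).Normal := by
  rw [← Subgroup.commutator_top_right_le_iff, ← hH.zero]
  exact hH.commutator_le n 0

theorem comm_mem (hH : IsNSeries H) {i j : ℕ} {g h : G} (hg : g ∈ H i) (hh : h ∈ H j) :
    ⁅g, h⁆ ∈ H (i + j) :=
  hH.commutator_le i j (Subgroup.commutator_mem_commutator hg hh)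

theorem comap {K : Type*} [Group K] (hH : IsNSeries H) (f : K →* G) :
    IsNSeries fun n => (H n).comap f where
  antitone _ _ h := Subgroup.comap_mono (hH.antitone h)
  zero := by simp [hH.zero]
  commutator_le i j := by
    rw [Subgroup.commutator_le]
    intro g hg h hh
    rw [Subgroup.mem_comap, map_commutatorElement]
    exact hH.comm_mem hg hh

theorem map {K : Type*} [Group K] (hH : IsNSeries H) {f : G →* K} (hf : Function.Surjective f) :
    IsNSeries fun n => (H n).map f where
  antitone _ _ h := Subgroup.map_mono (hH.antitone h)
  zero := by simp [hH.zero, Subgroup.map_top_of_surjective f hf]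
  commutator_le i j := by
    rw [← Subgroup.map_commutator]
    exact Subgroup.map_mono (hH.commutator_le i j)

/-- In an `N`-series, changing the entries of a commutator by elements `a` steps deeper
changes the commutator by an element `a` steps deeper. -/
theorem commutator_mul_inv_mem (hH : IsNSeries H) {i j a : ℕ} {u v g h : G}
    (hg : g ∈ H i) (hh : h ∈ H j) (hu : u ∈ H (i + a)) (hv : v ∈ H (j + a)) :
    ⁅u * g, v * h⁆ * ⁅g, h⁆⁻¹ ∈ H (i + j + a) := by
  have := hH.normal (i + j + a)
  have hvh : v * h ∈ H j := mul_mem (hH.antitone (Nat.le_add_right _ _) hv) hh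
  have h1 : ⁅u, v * h⁆ ∈ H (i + j + a) := by
    have := hH.comm_mem hu hvh
    rwa [add_right_comm] at this
  have h2 : ⁅g, v⁆ ∈ H (i + j + a) := by
    have := hH.comm_mem hg hv
    rwa [← add_assoc] at this
  have h3 : ⁅u, ⁅g, v * h⁆⁆ ∈ H (i + j + a) :=
    hH.antitone (by omega) (hH.comm_mem hu (hH.comm_mem hg hvh))
  have h4 : ⁅v, ⁅g, h⁆⁆ ∈ H (i + j + a) :=
    hH.antitone (by omega) (hH.comm_mem hv (hH.comm_mem hg hh))
  -- Each factor on the right is a commutator with `u` or `v` as an entry, or a conjugate of one.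
  have key : ⁅u * g, v * h⁆ * ⁅g, h⁆⁻¹ =
      ⁅u, ⁅g, v * h⁆⁆ * (⁅g, v * h⁆ * ⁅u, v * h⁆ * ⁅g, v * h⁆⁻¹) * (⁅g, v⁆ * ⁅v, ⁅g, h⁆⁆) := by
    simp only [commutatorElement_def]
    group
  rw [key]
  exact mul_mem (mul_mem h3 (this.conj_mem _ h1 _)) (mul_mem h2 h4)

/-- If `φ` shifts the elements of `H j` by elements of `H (j + a)`, where `a > 0`, and the
series is finite, then `φ` maps every term onto itself. -/
theorem le_map_of_shift (hH : IsNSeries H) {n a : ℕ} (hn : H n = ⊥) (ha : 0 < a) {φ : G →* G}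
    (hφ : ∀ j, ∀ g ∈ H j, φ g * g⁻¹ ∈ H (j + a)) (j : ℕ) : H j ≤ (H j).map φ := by
  obtain hj | hj := le_total n j
  · have : H j = ⊥ := le_bot_iff.1 (hn ▸ hH.antitone hj)
    simp [this]
  -- The error `φ g * g⁻¹` lies strictly deeper, where a preimage is already known.
  · induction hj using Nat.decreasingInduction with
    | self => simp [hn]
    | of_succ j _ ih =>
      intro g hg
      obtain ⟨v, hv, hvu⟩ := ih (hH.antitone (by omega) (hφ j g hg))
      refine ⟨v⁻¹ * g, mul_mem (inv_mem (hH.antitone (Nat.le_succ j) hv)) hg, ?_⟩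
      simp [hvu]

theorem bijective_of_shift (hH : IsNSeries H) {n a : ℕ} (hn : H n = ⊥) (ha : 0 < a) {φ : G →* G}
    (hφ : ∀ j, ∀ g ∈ H j, φ g * g⁻¹ ∈ H (j + a)) : Function.Bijective φ := by
  constructor
  · rw [injective_iff_map_eq_one]
    intro g hg
    have : ∀ j, g ∈ H j := by
      intro j
      induction j with
      | zero => simp [hH.zero]
      | succ j ih =>
        have := hφ j g ih
        rw [hg, one_mul, inv_mem_iff] at this
        exact hH.antitone (by omega) this
    simpa [hn] using this n
  · intro g
    have := hH.le_map_of_shift hn ha hφ 0 (by simp [hH.zero] : g ∈ H 0)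
    obtain ⟨h, -, hh⟩ := this
    exact ⟨h, hh⟩

/-- The automorphisms with this shift property form a subgroup; closure under inverses needs
`le_map_of_shift`, since the preimage must lie in the same term. -/
theorem shift_zpow (hH : IsNSeries H) {n a : ℕ} (hn : H n = ⊥) (ha : 0 < a) {φ : MulAut G}
    (hφ : ∀ j, ∀ g ∈ H j, φ g * g⁻¹ ∈ H (j + a)) (e : ℤ) :
    ∀ j, ∀ g ∈ H j, (φ ^ e) g * g⁻¹ ∈ H (j + a) := by
  let S : Subgroup (MulAut G) :=
    { carrier := {ψ | ∀ j, ∀ g ∈ H j, ψ g * g⁻¹ ∈ H (j + a)}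
      one_mem' := fun j g _ => by simp
      mul_mem' := by
        intro α β hα hβ j g hg
        have h1 : β g ∈ H j := by
          have := mul_mem (hH.antitone (Nat.le_add_right _ _) (hβ j g hg)) hg
          simpa using this
        have := mul_mem (hα j _ h1) (hβ j g hg)
        simpa [mul_assoc] using this
      inv_mem' := by
        intro α hα j g hg
        obtain ⟨h, hh, rfl⟩ :=
          hH.le_map_of_shift hn ha (φ := α.toMonoidHom) (fun j g hg => hα j g hg) j hg
        have := inv_mem (hα j h hh)
        simpa using this }
  exact S.zpow_mem (show φ ∈ S from hφ) e

end IsNSeries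

/-! ### Extending an `N`-series by an infinite cyclic group -/

/-- The series of the semidirect product of `N` with the infinite cyclic group, whose terms are
those of `H`, extended by the cyclic group up to the index `a`. -/
def semidirectSeries {N : Type*} [Group N] (H : ℕ → Subgroup N) (φ : MulAut N) (a : ℕ)
    (hφ : ∀ (e : ℤ) (j : ℕ), ∀ g ∈ H j, (φ ^ e) g ∈ H j) (j : ℕ) :
    Subgroup (N ⋊[zpowersHom (MulAut N) φ] Multiplicative ℤ) where
  carrier := {p | p.left ∈ H j ∧ (a < j → p.right = 1)}
  one_mem' := by simp
  mul_mem' := by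
    rintro p q ⟨hp, hp'⟩ ⟨hq, hq'⟩
    refine ⟨?_, fun h => by simp [hp' h, hq' h]⟩
    rw [SemidirectProduct.mul_left, zpowersHom_apply]
    exact mul_mem hp (hφ _ _ _ hq)
  inv_mem' := by
    rintro p ⟨hp, hp'⟩
    refine ⟨?_, fun h => by simp [hp' h]⟩
    rw [SemidirectProduct.inv_left, zpowersHom_apply]
    exact hφ _ _ _ (inv_mem hp)

theorem isNSeries_semidirectSeries {N : Type*} [Group N] {H : ℕ → Subgroup N} (hH : IsNSeries H)
    {φ : MulAut N} {a : ℕ} (hφ : ∀ (e : ℤ) (j : ℕ), ∀ g ∈ H j, (φ ^ e) g ∈ H j)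
    (hφa : ∀ (e : ℤ) (j : ℕ), ∀ g ∈ H j, (φ ^ e) g * g⁻¹ ∈ H (j + a)) :
    IsNSeries (semidirectSeries H φ a hφ) where
  antitone i j hij p hp := ⟨hH.antitone hij hp.1, fun h => hp.2 (by omega)⟩
  zero := by
    ext p
    simp [semidirectSeries, hH.zero, ← SetLike.mem_coe]
  commutator_le i j := by
    rw [Subgroup.commutator_le]
    rintro p ⟨hp, hp'⟩ q ⟨hq, hq'⟩
    refine ⟨?_, fun _ => ?_⟩
    swap
    · simp [commutatorElement_def]
    have hn := hH.normal (i + j)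
    obtain ⟨g, e⟩ := p
    obtain ⟨h, f⟩ := q
    obtain ⟨e, rfl⟩ := Multiplicative.ofAdd.surjective e
    obtain ⟨f, rfl⟩ := Multiplicative.ofAdd.surjective f
    simp only at hp hp' hq hq'
    have hgf : (φ ^ f) g * g⁻¹ ∈ H (i + j) := by
      -- Beyond index `a` the cyclic part is trivial; up to `a`, a shift by `a` already reaches `H
      -- (i + j)`.
      by_cases hj : a < j
      · have : f = 0 := by simpa using hq' hj
        simp [this]
      · exact hH.antitone (by omega) (hφa f i g hp)
    have hhe : (φ ^ e) h * h⁻¹ ∈ H (i + j) := by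
      by_cases hi : a < i
      · have : e = 0 := by simpa using hp' hi
        simp [this]
      · exact hH.antitone (by omega) (hφa e j h hq)
    have hleft : ∀ p q : N ⋊[zpowersHom (MulAut N) φ] Multiplicative ℤ, ⁅p, q⁆.left =
        p.left * (φ ^ p.right.toAdd) q.left * ((φ ^ q.right.toAdd) p.left)⁻¹ * q.left⁻¹ := by
      rintro ⟨g, e⟩ ⟨h, f⟩
      simp [commutatorElement_def, zpowersHom_apply, mul_assoc]
      have hc : ∀ x, (φ ^ e.toAdd) ((φ ^ f.toAdd) x) = (φ ^ f.toAdd) ((φ ^ e.toAdd) x) := by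
        intro x
        simp only [← MulAut.mul_apply, ← zpow_add, add_comm]
      simp [hc]
    rw [hleft]
    simp only [toAdd_ofAdd]
    have hgh := hH.comm_mem hp hq
    have key : g * (φ ^ e) h * ((φ ^ f) g)⁻¹ * h⁻¹ =
        (g * ((φ ^ e) h * h⁻¹) * g⁻¹) * ((g * h * g⁻¹) * ((φ ^ f) g * g⁻¹)⁻¹ * (g * h * g⁻¹)⁻¹) *
          ⁅g, h⁆ := by
      simp only [commutatorElement_def]
      group
    rw [key]
    exact mul_mem (mul_mem (hn.conj_mem _ hhe _) (hn.conj_mem _ (inv_mem hgf) _)) hgh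

/-! ### Weighted series of free groups -/

/-- The fastest descending `N`-series of the free group on `X` whose term of index `w x`
contains the letter `x`. -/
def weightedSeries {X : Type*} (w : X → ℕ) (n : ℕ) : Subgroup (FreeGroup X) :=
  sInf {K | ∃ H : ℕ → Subgroup (FreeGroup X),
    IsNSeries H ∧ (∀ x, FreeGroup.of x ∈ H (w x)) ∧ K = H n}

section WeightedSeries

variable {X : Type*} {w : X → ℕ}

theorem weightedSeries_le {H : ℕ → Subgroup (FreeGroup X)} (hH : IsNSeries H)
    (hw : ∀ x, FreeGroup.of x ∈ H (w x)) (n : ℕ) : weightedSeries w n ≤ H n :=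
  sInf_le ⟨H, hH, hw, rfl⟩

theorem of_mem_weightedSeries (x : X) : FreeGroup.of x ∈ weightedSeries w (w x) := by
  rw [weightedSeries, Subgroup.mem_sInf]
  rintro _ ⟨H, -, hw, rfl⟩
  exact hw x

theorem isNSeries_weightedSeries (w : X → ℕ) : IsNSeries (weightedSeries w) where
  antitone i j hij := le_sInf <| by
    rintro _ ⟨H, hH, hw, rfl⟩
    exact (weightedSeries_le hH hw j).trans (hH.antitone hij)
  zero := by
    rw [eq_top_iff]
    refine le_sInf ?_
    rintro _ ⟨H, hH, -, rfl⟩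
    exact hH.zero.ge
  commutator_le i j := le_sInf <| by
    rintro _ ⟨H, hH, hw, rfl⟩
    exact (Subgroup.commutator_mono (weightedSeries_le hH hw i)
      (weightedSeries_le hH hw j)).trans (hH.commutator_le i j)

instance weightedSeries_normal (w : X → ℕ) (n : ℕ) : (weightedSeries w n).Normal :=
  (isNSeries_weightedSeries w).normal n

theorem map_mem_of_mem_weightedSeries {G : Type*} [Group G] {H : ℕ → Subgroup G}
    (hH : IsNSeries H) (f : FreeGroup X →* G) (hf : ∀ x, f (FreeGroup.of x) ∈ H (w x)) {n : ℕ}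
    {g : FreeGroup X} (hg : g ∈ weightedSeries w n) : f g ∈ H n :=
  weightedSeries_le (hH.comap f) hf n hg

theorem weightedSeries_eq_top {n : ℕ} (hw : ∀ x, n ≤ w x) : weightedSeries w n = ⊤ := by
  rw [eq_top_iff, ← FreeGroup.closure_range_of, Subgroup.closure_le]
  rintro _ ⟨x, rfl⟩
  exact (isNSeries_weightedSeries w).antitone (hw x) (of_mem_weightedSeries x)

/-- The elements obeying the bound form an `N`-series `S` containing the letters at their weights,
by `commutator_mul_inv_mem`; minimality of the weighted series does the rest. -/
theorem shift_of_letters {a : ℕ} {f : FreeGroup X →* FreeGroup X}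
    (hf : ∀ x, f (FreeGroup.of x) * (FreeGroup.of x)⁻¹ ∈ weightedSeries w (w x + a)) (j : ℕ)
    {g : FreeGroup X} (hg : g ∈ weightedSeries w j) :
    f g * g⁻¹ ∈ weightedSeries w (j + a) := by
  have hW := isNSeries_weightedSeries w
  let S (j : ℕ) : Subgroup (FreeGroup X) :=
    { carrier := {g | g ∈ weightedSeries w j ∧ f g * g⁻¹ ∈ weightedSeries w (j + a)}
      one_mem' := by simp
      mul_mem' := by
        rintro g h ⟨hg, hg'⟩ ⟨hh, hh'⟩
        refine ⟨mul_mem hg hh, ?_⟩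
        have : f (g * h) * (g * h)⁻¹ = f g * g⁻¹ * (g * (f h * h⁻¹) * g⁻¹) := by
          rw [map_mul]; group
        rw [this]
        exact mul_mem hg' ((hW.normal _).conj_mem _ hh' _)
      inv_mem' := by
        rintro g ⟨hg, hg'⟩
        refine ⟨inv_mem hg, ?_⟩
        rw [map_inv, inv_inv]
        have := (hW.normal _).conj_mem _ (inv_mem hg') g⁻¹
        simpa [mul_assoc] using this }
  have hSmem : ∀ x, FreeGroup.of x ∈ S (w x) := fun x => ⟨of_mem_weightedSeries x, hf x⟩
  have hanti : Antitone S := fun i j hij g hg =>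
    ⟨hW.antitone hij hg.1, hW.antitone (by omega) hg.2⟩
  have hS : IsNSeries S := by
    refine ⟨hanti, ?_, ?_⟩
    · rw [eq_top_iff, ← FreeGroup.closure_range_of, Subgroup.closure_le]
      rintro _ ⟨x, rfl⟩
      exact hanti (Nat.zero_le _) (hSmem x)
    · intro i j
      rw [Subgroup.commutator_le]
      rintro g ⟨hg, hg'⟩ h ⟨hh, hh'⟩
      refine ⟨hW.comm_mem hg hh, ?_⟩
      have := hW.commutator_mul_inv_mem hg hh hg' hh'
      simpa [map_commutatorElement] using this
  exact (weightedSeries_le hS hSmem j hg).2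

end WeightedSeries

/-! ### Elimination of a letter -/

/-- The `i`-th iterated commutator of `y` with `x`. -/
def iteratedShift {G : Type*} [Group G] (x y : G) : ℕ → G
  | 0 => y
  | i + 1 => (iteratedShift x y i)⁻¹ * (x * iteratedShift x y i * x⁻¹)

theorem IsNSeries.iteratedShift_mem {G : Type*} [Group G] {H : ℕ → Subgroup G} (hH : IsNSeries H)
    {a b : ℕ} {x y : G} (hx : x ∈ H a) (hy : y ∈ H b) (i : ℕ) :
    iteratedShift x y i ∈ H (b + i * a) := by
  induction i with
  | zero => simpa [iteratedShift]
  | succ i ih =>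
    have : iteratedShift x y (i + 1) = ⁅(iteratedShift x y i)⁻¹, x⁆ := by
      simp [iteratedShift, commutatorElement_def, mul_assoc]
    rw [this]
    have := hH.comm_mem (inv_mem ih) hx
    rwa [add_assoc, ← Nat.succ_mul] at this

theorem map_mulAut_zpow_apply {N Q : Type*} [Group N] [Group Q] {B : N →* Q} {φ : MulAut N} {q : Q}
    (h : ∀ g, B (φ g) = q * B g * q⁻¹) (e : ℤ) (g : N) :
    B ((φ ^ e) g) = q ^ e * B g * (q ^ e)⁻¹ := by
  let S : Subgroup (MulAut N × Q) :=
    { carrier := {p | ∀ g, B (p.1 g) = p.2 * B g * p.2⁻¹}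
      one_mem' := by simp
      mul_mem' := by
        intro p q hp hq g
        simp [hp (q.1 g), hq g, mul_assoc]
      inv_mem' := by
        intro p hp g
        have := hp (p.1⁻¹ g)
        simp only [MulAut.apply_inv_self] at this
        simp [this, mul_assoc] }
  exact S.zpow_mem (show (φ, q) ∈ S from h) e g

/-- Eliminating a letter `x` of positive weight: the free group on `X` modulo the `n`-th term
embeds into an extension of the free group on the iterated commutators of the other letters
with `x`, modulo its `n`-th term, by an infinite cyclic group. -/
theorem weightedSeries_sq_of_eliminate {X : Type*} (w : X → ℕ) (n : ℕ) (x : X) (hx : 0 < w x)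
    (hxn : w x < n)
    (h : ∀ g : FreeGroup ({y // y ≠ x} × ℕ),
      g ^ 2 ∈ weightedSeries (fun p : {y // y ≠ x} × ℕ => w p.1 + p.2 * w x) n →
      g ∈ weightedSeries (fun p : {y // y ≠ x} × ℕ => w p.1 + p.2 * w x) n)
    (g : FreeGroup X) (hg : g ^ 2 ∈ weightedSeries w n) : g ∈ weightedSeries w n := by
  classical
  set w' : {y // y ≠ x} × ℕ → ℕ := fun p => w p.1 + p.2 * w x with hw'
  let W := weightedSeries w'
  have hW : IsNSeries W := isNSeries_weightedSeries w'
  let N := FreeGroup ({y // y ≠ x} × ℕ) ⧸ W n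
  let π : FreeGroup ({y // y ≠ x} × ℕ) →* N := QuotientGroup.mk' (W n)
  have hπ : Function.Surjective π := QuotientGroup.mk'_surjective _
  let H : ℕ → Subgroup N := fun j => (W j).map π
  have hH : IsNSeries H := hW.map hπ
  have hHn : H n = ⊥ := by
    rw [Subgroup.map_eq_bot_iff, QuotientGroup.ker_mk']
  -- Models conjugation by `x`: if `yᵢ` is the `i`-th iterated commutator, then `x yᵢ x⁻¹ = yᵢ
  -- yᵢ₊₁`.
  let f : FreeGroup ({y // y ≠ x} × ℕ) →* FreeGroup ({y // y ≠ x} × ℕ) :=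
    FreeGroup.lift fun p => FreeGroup.of p * FreeGroup.of (p.1, p.2 + 1)
  have hfshift : ∀ j, ∀ g ∈ W j, f g * g⁻¹ ∈ W (j + w x) := by
    intro j g hg
    refine shift_of_letters (fun p => ?_) j hg
    simp only [f, FreeGroup.lift_apply_of]
    refine (hW.normal _).conj_mem _ ?_ _
    have := of_mem_weightedSeries (w := w') (p.1, p.2 + 1)
    have e : w' (p.1, p.2 + 1) = w' p + w x := by simp only [hw']; ring
    rwa [e] at this
  have hfle : W n ≤ (W n).comap f := by
    intro g hg
    have := mul_mem (hW.antitone (Nat.le_add_right _ _) (hfshift n g hg)) hg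
    simpa using this
  let fN : N →* N := QuotientGroup.map (W n) (W n) f hfle
  have hfN : ∀ g, fN (π g) = π (f g) := fun g => rfl
  have hfNshift : ∀ j, ∀ g ∈ H j, fN g * g⁻¹ ∈ H (j + w x) := by
    rintro j _ ⟨g, hg, rfl⟩
    exact ⟨_, hfshift j g hg, by simp [hfN]⟩
  let φ : MulAut N := MulEquiv.ofBijective fN (hH.bijective_of_shift hHn hx hfNshift)
  have hφπ : ∀ g, φ (π g) = π (f g) := fun g => rfl
  have hφshift := hH.shift_zpow hHn hx (φ := φ) hfNshift
  have hφle : ∀ (e : ℤ) (j : ℕ), ∀ g ∈ H j, (φ ^ e) g ∈ H j := by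
    intro e j g hg
    have := mul_mem (hH.antitone (Nat.le_add_right _ _) (hφshift e j g hg)) hg
    simpa using this
  let P := N ⋊[zpowersHom (MulAut N) φ] Multiplicative ℤ
  let M := semidirectSeries H φ (w x) hφle
  have hM : IsNSeries M := isNSeries_semidirectSeries hH hφle hφshift
  have hMn : M n = ⊥ := by
    rw [eq_bot_iff]
    rintro p ⟨hp, hp'⟩
    rw [hHn, Subgroup.mem_bot] at hp
    exact SemidirectProduct.ext hp (hp' hxn)
  let F : FreeGroup X →* P := FreeGroup.lift fun y =>
    if hy : y = x then SemidirectProduct.inr (.ofAdd 1)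
    else SemidirectProduct.inl (π (FreeGroup.of (⟨y, hy⟩, 0)))
  have hFx : F (FreeGroup.of x) = SemidirectProduct.inr (.ofAdd 1) := by simp [F]
  have hFy : ∀ y (hy : y ≠ x), F (FreeGroup.of y) =
      SemidirectProduct.inl (π (FreeGroup.of (⟨y, hy⟩, 0))) := fun y hy => by simp [F, hy]
  have hFn : ∀ g ∈ weightedSeries w n, F g = 1 := by
    intro g hg
    rw [← Subgroup.mem_bot, ← hMn]
    refine map_mem_of_mem_weightedSeries hM F (fun y => ?_) hg
    by_cases hy : y = x
    · subst hy
      rw [hFx]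
      exact ⟨by simp, by simp⟩
    · rw [hFy y hy]
      refine ⟨?_, by simp⟩
      have := of_mem_weightedSeries (w := w') (⟨y, hy⟩, 0)
      simp only [hw', zero_mul, add_zero] at this
      exact ⟨_, this, rfl⟩
  let Q := FreeGroup X ⧸ weightedSeries w n
  let ρ : FreeGroup X →* Q := QuotientGroup.mk' _
  let c : {y // y ≠ x} × ℕ → FreeGroup X := fun p =>
    iteratedShift (FreeGroup.of x) (FreeGroup.of (p.1 : X)) p.2
  let B : N →* Q := QuotientGroup.lift (W n) (ρ.comp (FreeGroup.lift c)) <| by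
    intro g hg
    refine (QuotientGroup.eq_one_iff (FreeGroup.lift c g)).2 ?_
    refine map_mem_of_mem_weightedSeries (isNSeries_weightedSeries w) _ (fun p => ?_) hg
    rw [FreeGroup.lift_apply_of]
    exact (isNSeries_weightedSeries w).iteratedShift_mem (of_mem_weightedSeries x)
      (of_mem_weightedSeries _) _
  have hBπ : ∀ g, B (π g) = ρ (FreeGroup.lift c g) := fun g => rfl
  have hBφ : ∀ g, B (φ g) = ρ (FreeGroup.of x) * B g * (ρ (FreeGroup.of x))⁻¹ := by
    have : (B.comp φ.toMonoidHom).comp π =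
        ((MulAut.conj (ρ (FreeGroup.of x))).toMonoidHom.comp B).comp π := by
      ext p
      simp only [MonoidHom.comp_apply, MulEquiv.coe_toMonoidHom, hφπ, hBπ, MulAut.conj_apply, f,
        FreeGroup.lift_apply_of, map_mul, ← map_inv]
      rw [← map_mul, ← map_mul, ← map_mul]
      congr 1
      simp [c, iteratedShift]
    intro g
    obtain ⟨g, rfl⟩ := hπ g
    exact DFunLike.congr_fun this g
  have hBφz : ∀ (e : ℤ) (g : N),
      B ((φ ^ e) g) = ρ (FreeGroup.of x) ^ e * B g * (ρ (FreeGroup.of x) ^ e)⁻¹ :=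
    map_mulAut_zpow_apply hBφ
  -- `R ∘ F` will be the quotient map `ρ`, so `F` kills nothing outside the `n`-th term.
  let R : P →* Q := SemidirectProduct.lift B (zpowersHom Q (ρ (FreeGroup.of x))) <| by
    intro e
    ext g
    simpa [zpowersHom_apply, ← map_zpow] using hBφz e.toAdd _
  have hRl : ∀ m, R (SemidirectProduct.inl m) = B m := SemidirectProduct.lift_inl _ _ _
  have hRr : ∀ e, R (SemidirectProduct.inr e) = ρ (FreeGroup.of x) ^ e.toAdd :=
    SemidirectProduct.lift_inr _ _ _
  have hRF : R.comp F = ρ := by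
    ext y
    by_cases hy : y = x
    · rw [MonoidHom.comp_apply, hy, hFx, hRr, toAdd_ofAdd, zpow_one]
    · rw [MonoidHom.comp_apply, hFy y hy, hRl, hBπ, FreeGroup.lift_apply_of]
      rfl
  -- Since `ℤ` is torsion-free, `F g` lies in `N`, where `h` applies.
  have hFg : (F g) ^ 2 = 1 := by rw [← map_pow]; exact hFn _ hg
  have hright : (F g).right = 1 := by
    have := congrArg SemidirectProduct.rightHom hFg
    rw [map_pow, map_one] at this
    simpa [SemidirectProduct.rightHom] using this
  have hleft : (F g).left = 1 := by
    have hFl : F g = SemidirectProduct.inl (F g).left := by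
      ext <;> simp [hright]
    obtain ⟨g', hg'⟩ := hπ (F g).left
    rw [hFl, ← map_pow, ← hg', ← map_pow, ← map_one SemidirectProduct.inl,
      SemidirectProduct.inl_inj] at hFg
    rw [← hg']
    exact (QuotientGroup.eq_one_iff _).2 (h g' ((QuotientGroup.eq_one_iff _).1 hFg))
  have hF1 : F g = 1 := SemidirectProduct.ext hleft hright
  have := DFunLike.congr_fun hRF g
  rw [MonoidHom.comp_apply, hF1, map_one] at this
  exact (QuotientGroup.eq_one_iff _).1 this.symm

/-- Double induction: on `d`, which bounds how far weights fall below `n`, then on the number of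
letters of the least possible weight. Eliminating such a letter adds only strictly heavier ones. -/
theorem mem_weightedSeries_of_sq_mem (n d : ℕ) : ∀ {X : Type u} (w : X → ℕ), (∀ x, 0 < w x) →
    (∀ x, n ≤ w x + d) → (∀ b < n, {x | w x = b}.Finite) → ∀ g : FreeGroup X,
    g ^ 2 ∈ weightedSeries w n → g ∈ weightedSeries w n := by
  induction d with
  | zero =>
    intro X w _ hd _ g _
    rw [weightedSeries_eq_top (by simpa using hd)]
    trivial
  | succ d ihd =>
    suffices ∀ c : ℕ, ∀ {X : Type u} (w : X → ℕ), {x | w x + d < n}.ncard ≤ c → (∀ x, 0 < w x) →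
        (∀ x, n ≤ w x + (d + 1)) → (∀ b < n, {x | w x = b}.Finite) → ∀ g : FreeGroup X,
        g ^ 2 ∈ weightedSeries w n → g ∈ weightedSeries w n from
      fun {X} w hw hd hfin => this _ w le_rfl hw hd hfin
    intro c
    induction c with
    | zero =>
      intro X w hc hw hd hfin
      refine ihd w hw (fun x => ?_) hfin
      -- Needed because `Set.ncard` is also `0` on infinite sets.
      have hS : {x | w x + d < n}.Finite := by
        by_cases hn : d < n
        · exact (hfin (n - (d + 1)) (by omega)).subset fun x hx => by
            have := hd x; simp only [Set.mem_ofPred_eq] at hx ⊢; omega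
        · convert Set.finite_empty
          ext x; simp; omega
      rw [nonpos_iff_eq_zero, Set.ncard_eq_zero hS] at hc
      by_contra hx
      exact (Set.eq_empty_iff_forall_notMem.1 hc x) (by simpa using hx)
    | succ c ihc =>
      intro X w hc hw hd hfin
      by_cases hex : ∃ x, w x + d < n
      swap
      · push Not at hex
        exact ihd w hw hex hfin
      obtain ⟨x, hx⟩ := hex
      have hS : {x | w x + d < n}.Finite :=
        (hfin (n - (d + 1)) (by omega)).subset fun y hy => by
          have := hd y; simp only [Set.mem_ofPred_eq] at hy ⊢; omega
      refine weightedSeries_sq_of_eliminate w n x (hw x) (by omega) ?_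
      refine ihc _ ?_ (fun p => ?_) (fun p => ?_) ?_
      · have hxS : x ∈ {x | w x + d < n} := hx
        have : ({x | w x + d < n} \ {x}).ncard ≤ c := by
          rw [Set.ncard_sdiff_singleton_of_mem hxS]
          omega
        -- A proper iterated commutator gains at least `w x > 0`, so it is not of least weight.
        have hp2 : ∀ p : {y // y ≠ x} × ℕ, w p.1 + p.2 * w x + d < n → p.2 = 0 := by
          intro p hp
          have h1 := hd p.1
          by_contra h0
          have := Nat.mul_le_mul (Nat.one_le_iff_ne_zero.2 h0) (hw x)
          omega
        refine le_trans (Set.ncard_le_ncard_of_injOn (fun p => (p.1 : X)) ?_ ?_ hS.sdiff) this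
        · intro p hp
          have := hp2 p hp
          refine ⟨?_, p.1.2⟩
          simp only [Set.mem_ofPred_eq] at hp ⊢
          omega
        · intro p hp q hq hpq
          exact Prod.ext (Subtype.ext hpq) ((hp2 p hp).trans (hp2 q hq).symm)
      · have := hw p.1
        omega
      · have := hd p.1
        omega
      · intro b hb
        -- In a new letter of weight `b`, both the old weight and the number of iterations are at
        -- most `b`.
        have hfin' : ((⋃ j ∈ Set.Iic b, {y | w y = j}) ×ˢ Set.Iic b).Finite := by
          refine ((Set.finite_Iic b).biUnion fun j hj => hfin j ?_).prod (Set.finite_Iic b)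
          exact lt_of_le_of_lt hj hb
        refine (hfin'.preimage (f := fun p : {y // y ≠ x} × ℕ => ((p.1 : X), p.2)) ?_).subset ?_
        · intro p _ q _ hpq
          simp only [Prod.mk.injEq] at hpq
          exact Prod.ext (Subtype.ext hpq.1) hpq.2
        · intro p hp
          simp only [Set.mem_ofPred_eq] at hp
          have := Nat.le_mul_of_pos_right p.2 (hw x)
          simp only [Set.mem_preimage, Set.mem_prod, Set.mem_iUnion, Set.mem_ofPred_eq,
            Set.mem_Iic, exists_prop, exists_eq_right']
          omega

/-! ### Lower central series and 2-torsion in free nilpotent groups -/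

section LowerCentralSeries

variable {G : Type*} [Group G]

/-- The three subgroups lemma, applied in the quotient by `K`. -/
theorem Subgroup.commutator_commutator_le_of_rotate {H₁ H₂ H₃ K : Subgroup G} [hK : K.Normal]
    (h1 : ⁅⁅H₂, H₃⁆, H₁⁆ ≤ K) (h2 : ⁅⁅H₃, H₁⁆, H₂⁆ ≤ K) : ⁅⁅H₁, H₂⁆, H₃⁆ ≤ K := by
  have key : ∀ L : Subgroup G, L ≤ K ↔ L.map (QuotientGroup.mk' K) = ⊥ := by
    intro L
    rw [Subgroup.map_eq_bot_iff, QuotientGroup.ker_mk']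
  rw [key] at *
  simp only [Subgroup.map_commutator] at *
  exact Subgroup.commutator_commutator_eq_bot_of_rotate h1 h2

theorem Subgroup.commutator_lowerCentralSeries_le (i j : ℕ) :
    ⁅(⊤ : Subgroup G).lowerCentralSeries i, (⊤ : Subgroup G).lowerCentralSeries j⁆ ≤
      (⊤ : Subgroup G).lowerCentralSeries (i + j + 1) := by
  induction i generalizing j with
  | zero =>
    rw [Subgroup.lowerCentralSeries_zero, Subgroup.commutator_comm, zero_add,
      Subgroup.lowerCentralSeries_succ]
  | succ i ih =>
    nth_rw 1 [Subgroup.lowerCentralSeries_succ]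
    apply Subgroup.commutator_commutator_le_of_rotate
    · rw [Subgroup.commutator_comm ⊤, ← Subgroup.lowerCentralSeries_succ, Subgroup.commutator_comm]
      have := ih (j + 1)
      rwa [show i + (j + 1) + 1 = i + 1 + j + 1 by ring] at this
    · rw [Subgroup.commutator_comm (Subgroup.lowerCentralSeries _ j),
        show i + 1 + j + 1 = (i + j + 1) + 1 by ring, Subgroup.lowerCentralSeries_succ _ (i + j + 1)]
      exact Subgroup.commutator_mono (ih j) le_rfl

theorem isNSeries_lowerCentralSeries :
    IsNSeries fun n => (⊤ : Subgroup G).lowerCentralSeries (n - 1) where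
  antitone i j h := Subgroup.lowerCentralSeries_antitone _ (Nat.sub_le_sub_right h 1)
  zero := rfl
  commutator_le i j := by
    refine (Subgroup.commutator_lowerCentralSeries_le _ _).trans ?_
    exact Subgroup.lowerCentralSeries_antitone _ (by omega)

theorem IsNSeries.lowerCentralSeries_le {H : ℕ → Subgroup G} (hH : IsNSeries H) (h1 : H 1 = ⊤)
    (n : ℕ) : (⊤ : Subgroup G).lowerCentralSeries n ≤ H (n + 1) := by
  induction n with
  | zero => simp [h1]
  | succ n ih =>
    rw [Subgroup.lowerCentralSeries_succ]
    refine (Subgroup.commutator_mono ih h1.ge).trans (hH.commutator_le _ _)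

end LowerCentralSeries

theorem exists_finset_lift_eq_self {X : Type*} [DecidableEq X] (g : FreeGroup X) :
    ∃ Y : Finset X, ∀ Z, Y ⊆ Z →
      FreeGroup.lift (fun x => if x ∈ Z then FreeGroup.of x else 1) g = g := by
  induction g using FreeGroup.induction_on with
  | C1 => exact ⟨∅, by simp⟩
  | of x => exact ⟨{x}, fun Z hZ => by simp [Finset.singleton_subset_iff.1 hZ]⟩
  | inv_of x _ => exact ⟨{x}, fun Z hZ => by simp [Finset.singleton_subset_iff.1 hZ]⟩
  | mul g h hg hh =>
    obtain ⟨Y, hY⟩ := hg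
    obtain ⟨Y', hY'⟩ := hh
    refine ⟨Y ∪ Y', fun Z hZ => ?_⟩
    rw [map_mul, hY Z (Finset.union_subset_left hZ), hY' Z (Finset.union_subset_right hZ)]

/-- The quotients of a free group by the terms of its lower central series have no elements
of order two. -/
theorem FreeGroup.mem_lowerCentralSeries_of_sq_mem {X : Type*} (k : ℕ) (g : FreeGroup X)
    (hg : g ^ 2 ∈ (⊤ : Subgroup (FreeGroup X)).lowerCentralSeries k) :
    g ∈ (⊤ : Subgroup (FreeGroup X)).lowerCentralSeries k := by
  classical
  obtain ⟨Y, hY⟩ := exists_finset_lift_eq_self g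
  -- Weight `k + 1` puts the letters outside `Y` into the term under study, leaving finitely many
  -- lighter ones.
  let w : X → ℕ := fun x => if x ∈ Y then 1 else k + 1
  have hw : ∀ x, 0 < w x := fun x => by simp only [w]; split_ifs <;> omega
  have hW := isNSeries_weightedSeries w
  have hW1 : weightedSeries w 1 = ⊤ := weightedSeries_eq_top hw
  have hgW := mem_weightedSeries_of_sq_mem (k + 1) k w hw
    (fun x => by have := hw x; omega) (fun b hb => by
      refine Y.finite_toSet.subset fun x hx => ?_
      by_contra hxY
      simp only [Finset.mem_coe] at hxY
      simp only [w, hxY, if_false, Set.mem_ofPred_eq] at hx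
      omega) g (hW.lowerCentralSeries_le hW1 k hg)
  -- The retraction onto the letters of `Y` fixes `g` and kills the heavy letters, so it carries the
  -- weighted series into the lower central series.
  rw [← hY Y subset_rfl]
  refine map_mem_of_mem_weightedSeries (n := k + 1) isNSeries_lowerCentralSeries _ (fun x => ?_) hgW
  rw [FreeGroup.lift_apply_of]
  by_cases hx : x ∈ Y <;> simp [w, hx]

theorem FreeNilpotentGroup.orderOf_ne_two {k : ℕ} {X : Type*} (a : FreeNilpotentGroup k X) :
    orderOf a ≠ 2 := by
  intro ha
  obtain ⟨g, rfl⟩ := QuotientGroup.mk_surjective a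
  have h2 : g ^ 2 ∈ (⊤ : Subgroup (FreeGroup X)).lowerCentralSeries k := by
    rw [← QuotientGroup.eq_one_iff, QuotientGroup.mk_pow, ← ha, pow_orderOf_eq_one]
  rw [(QuotientGroup.eq_one_iff g).2 (FreeGroup.mem_lowerCentralSeries_of_sq_mem k g h2),
    orderOf_one] at ha
  omega

/-! ### Reduced words in free products -/

namespace Monoid.CoprodI

variable {ι : Type*} {G : ι → Type*} [∀ i, Group (G i)]

/-- The list of letters of the reduced word which represents `x`. -/
noncomputable def normalForm (x : CoprodI G) : List (Σ i, G i) := by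
  classical exact (Word.equiv x).toList

/-- The product of a list of letters. -/
def listProd (l : List (Σ i, G i)) : CoprodI G :=
  (l.map fun a => of a.2).prod

@[simp]
theorem listProd_nil : listProd ([] : List (Σ i, G i)) = 1 := rfl

@[simp]
theorem listProd_cons (a : Σ i, G i) (l : List (Σ i, G i)) :
    listProd (a :: l) = of a.2 * listProd l := by
  simp [listProd]

@[simp]
theorem listProd_append (l l' : List (Σ i, G i)) :
    listProd (l ++ l') = listProd l * listProd l' := by
  simp [listProd]

@[simp]
theorem listProd_normalForm (x : CoprodI G) : listProd (normalForm x) = x := by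
  classical exact Word.equiv.left_inv x

theorem normalForm_word_prod (w : Word G) : normalForm w.prod = w.toList := by
  classical exact congrArg Word.toList (Word.equiv.right_inv w)

theorem normalForm_injective : Function.Injective (normalForm : CoprodI G → _) :=
  Function.LeftInverse.injective listProd_normalForm

theorem normalForm_listProd {l : List (Σ i, G i)} (h1 : ∀ a ∈ l, a.2 ≠ 1)
    (h2 : l.IsChain fun a b => a.1 ≠ b.1) : normalForm (listProd l) = l :=
  normalForm_word_prod ⟨l, h1, h2⟩

theorem ne_one_of_mem_normalForm {x : CoprodI G} {a : Σ i, G i} (ha : a ∈ normalForm x) :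
    a.2 ≠ 1 := by
  classical exact (Word.equiv x).ne_one a ha

theorem normalForm_isChain (x : CoprodI G) : (normalForm x).IsChain fun a b => a.1 ≠ b.1 := by
  classical exact (Word.equiv x).chain_ne

@[simp]
theorem normalForm_one : normalForm (1 : CoprodI G) = [] :=
  normalForm_listProd (l := []) (by simp) (by simp)

theorem normalForm_eq_nil {x : CoprodI G} : normalForm x = [] ↔ x = 1 := by
  rw [← normalForm_one, normalForm_injective.eq_iff]

theorem normalForm_of_mul {i : ι} {m : G i} (hm : m ≠ 1) {x : CoprodI G}
    (hx : ∀ a ∈ (normalForm x).head?, i ≠ a.1) :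
    normalForm (of m * x) = ⟨i, m⟩ :: normalForm x := by
  rw [← normalForm_listProd (l := ⟨i, m⟩ :: normalForm x)]
  · simp
  · simp only [List.mem_cons, forall_eq_or_imp]
    exact ⟨hm, fun a => ne_one_of_mem_normalForm⟩
  · exact List.isChain_cons.2 ⟨hx, normalForm_isChain x⟩

theorem normalForm_listProd_of_cons {x : CoprodI G} {a : Σ i, G i} {l : List (Σ i, G i)}
    (h : normalForm x = a :: l) : normalForm (listProd l) = l := by
  refine normalForm_listProd (fun b hb => ?_) ?_
  · exact ne_one_of_mem_normalForm (x := x) (by simp [h, hb])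
  · have := normalForm_isChain x
    rw [h] at this
    exact this.tail

theorem ne_head_of_normalForm_cons {x : CoprodI G} {a : Σ i, G i} {l : List (Σ i, G i)}
    (h : normalForm x = a :: l) : ∀ b ∈ l.head?, a.1 ≠ b.1 := by
  have := normalForm_isChain x
  rw [h] at this
  exact (List.isChain_cons.1 this).1

/-- The new letter is prepended, cancels the first letter, or merges with it. -/
theorem normalForm_of_mul_cases {i : ι} {m : G i} (hm : m ≠ 1) (x : CoprodI G) :
    normalForm (of m * x) = ⟨i, m⟩ :: normalForm x ∨
    ∃ m₀ l, normalForm x = ⟨i, m₀⟩ :: l ∧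
      (normalForm (of m * x) = l ∨ ∃ m', normalForm (of m * x) = ⟨i, m'⟩ :: l) := by
  by_cases hx : ∀ a ∈ (normalForm x).head?, i ≠ a.1
  · exact Or.inl (normalForm_of_mul hm hx)
  push Not at hx
  obtain ⟨⟨j, m₀⟩, ha, rfl : i = j⟩ := hx
  obtain ⟨l, hl⟩ : ∃ l, normalForm x = ⟨i, m₀⟩ :: l := by
    cases h : normalForm x with
    | nil => simp [h] at ha
    | cons b l =>
      simp only [h, List.head?_cons, Option.mem_some_iff] at ha
      exact ⟨l, by rw [ha]⟩
  refine Or.inr ⟨m₀, l, hl, ?_⟩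
  have hnl := normalForm_listProd_of_cons hl
  have hx : of m * x = of (m * m₀) * listProd l := by
    rw [← listProd_normalForm x, hl]
    simp [mul_assoc]
  by_cases h1 : m * m₀ = 1
  · left
    rw [hx, h1, map_one, one_mul, hnl]
  · right
    refine ⟨m * m₀, ?_⟩
    rw [hx, normalForm_of_mul h1 (by rw [hnl]; exact ne_head_of_normalForm_cons hl), hnl]

theorem length_normalForm_of_mul_le {i : ι} (m : G i) (x : CoprodI G) :
    (normalForm (of m * x)).length ≤ (normalForm x).length + 1 := by
  by_cases hm : m = 1
  · simp [hm]
  obtain h | ⟨m₀, l, hl, h | ⟨m', h⟩⟩ := normalForm_of_mul_cases hm x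
  · simp [h]
  · simp [h, hl]; omega
  · simp [h, hl]

theorem length_normalForm_listProd_le (l : List (Σ i, G i)) :
    (normalForm (listProd l)).length ≤ l.length := by
  induction l with
  | nil => simp
  | cons a l ih =>
    rw [listProd_cons, List.length_cons]
    exact (length_normalForm_of_mul_le _ _).trans (by omega)

/-- A long suffix of the reduced word of `x` survives in the reduced word of `g * x`. -/
theorem exists_normalForm_mul_eq_append (g x : CoprodI G) {v t : List (Σ i, G i)}
    (hx : normalForm x = v ++ t) (hv : (normalForm g).length ≤ v.length) :
    ∃ v', normalForm (g * x) = v' ++ t ∧ v.length ≤ v'.length + (normalForm g).length := by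
  induction hl : normalForm g generalizing g with
  | nil =>
    rw [normalForm_eq_nil] at hl
    exact ⟨v, by simp [hl, hx], by simp⟩
  | cons a l ih =>
    have hnl := normalForm_listProd_of_cons hl
    have hlen : l.length + 1 ≤ v.length := by simpa [hl] using hv
    obtain ⟨v', hv', hvv'⟩ := ih (listProd l) (by rw [hnl]; omega) hnl
    have hg : g * x = of a.2 * (listProd l * x) := by
      rw [← mul_assoc, ← listProd_cons, ← hl, listProd_normalForm]
    have ha : a.2 ≠ 1 := ne_one_of_mem_normalForm (x := g) (by simp [hl])
    rw [hg]
    simp only [List.length_cons]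
    cases v' with
    | nil =>
      simp only [List.length_nil] at hvv'
      omega
    | cons b v' =>
      simp only [List.length_cons] at hvv'
      obtain h | ⟨m₀, l', hl', h⟩ := normalForm_of_mul_cases ha (listProd l * x)
      · exact ⟨a :: b :: v', by rw [h, hv']; rfl, by simp; omega⟩
      · rw [hv', List.cons_append, List.cons.injEq] at hl'
        rw [← hl'.2] at h
        obtain h | ⟨m', h⟩ := h
        · exact ⟨v', h, by omega⟩
        · exact ⟨⟨a.1, m'⟩ :: v', h, by simp; omega⟩

/-- Strip from `g` an initial letter in factor `i`, leaving `x`. If `x ≠ 1`, then a nontrivial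
letter of factor `i` times `x` is reduced, of length one more than `x`. As a value of `x * of b` it
would have to start in the factor of the first letter of `x`, or be shorter. -/
theorem mem_range_of_of_mul_eq {i : ι} {a b : G i} (ha : a ≠ 1) {g : CoprodI G}
    (h : of a * g = g * of b) : g ∈ (of : G i →* CoprodI G).range := by
  obtain ⟨c, x, hx, rfl⟩ : ∃ (c : G i) (x : CoprodI G),
      (∀ a ∈ (normalForm x).head?, i ≠ a.1) ∧ g = of c * x := by
    by_cases hg : ∀ a ∈ (normalForm g).head?, i ≠ a.1
    · exact ⟨1, g, hg, by simp⟩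
    push Not at hg
    obtain ⟨⟨j, m⟩, ha, rfl : i = j⟩ := hg
    cases hl : normalForm g with
    | nil => simp [hl] at ha
    | cons b l =>
      simp only [hl, List.head?_cons, Option.mem_some_iff] at ha
      subst ha
      refine ⟨m, listProd l, ?_, ?_⟩
      · rw [normalForm_listProd_of_cons hl]
        exact ne_head_of_normalForm_cons hl
      · rw [← listProd_normalForm g, hl, listProd_cons]
  have hac : c⁻¹ * a * c ≠ 1 := by
    intro h1
    apply ha
    have := congrArg (fun t => c * t * c⁻¹) h1
    simpa [mul_assoc] using this
  have h2 : of (c⁻¹ * a * c) * x = x * of b := by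
    rw [map_mul, map_mul, mul_assoc, mul_assoc, h, map_inv]
    simp [mul_assoc]
  have h3 := normalForm_of_mul hac hx
  cases hl : normalForm x with
  | nil =>
    rw [normalForm_eq_nil] at hl
    exact ⟨c, by simp [hl]⟩
  | cons d l =>
    exfalso
    have hxd : x * of b = of d.2 * (listProd l * of b) := by
      rw [← mul_assoc, ← listProd_cons, ← hl, listProd_normalForm]
    have hd : d.2 ≠ 1 := ne_one_of_mem_normalForm (x := x) (by simp [hl])
    have hlen : (normalForm (listProd l * of b)).length ≤ l.length + 1 := by
      have := length_normalForm_listProd_le (l ++ [⟨i, b⟩])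
      simpa using this
    rw [h2, hxd, hl] at h3
    obtain h | ⟨m₀, l', hl', h⟩ := normalForm_of_mul_cases hd (listProd l * of b)
    · rw [h, List.cons.injEq] at h3
      exact hx d (by simp [hl]) (congrArg Sigma.fst h3.1).symm
    · have h4 := congrArg List.length h3
      rw [hl'] at hlen
      simp only [List.length_cons] at h4 hlen
      obtain h | ⟨m', h⟩ := h <;> rw [h] at h4
      · omega
      · simp only [List.length_cons] at h4
        omega

/-- Every element of a free product is conjugate to an element of a factor or to an element
whose reduced word starts and ends in different factors. -/
theorem exists_conj_of_or_cyclicallyReduced (g : CoprodI G) :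
    g = 1 ∨ ∃ c : CoprodI G, (∃ (i : ι) (a : G i), c * g * c⁻¹ = of a) ∨
      ∃ a l b, normalForm (c * g * c⁻¹) = a :: (l ++ [b]) ∧ a.1 ≠ b.1 := by
  induction hn : (normalForm g).length using Nat.strong_induction_on generalizing g with
  | _ n ih =>
    subst hn
    cases hl : normalForm g with
    | nil => exact Or.inl (normalForm_eq_nil.1 hl)
    | cons a l =>
      have hg : g = of a.2 * listProd l := by
        rw [← listProd_normalForm g, hl, listProd_cons]
      right
      obtain rfl | ⟨l, b, rfl⟩ := l.eq_nil_or_concat'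
      · exact ⟨1, Or.inl ⟨a.1, a.2, by simp [hg]⟩⟩
      by_cases hab : a.1 = b.1
      · obtain ⟨i, a⟩ := a
        obtain ⟨j, b⟩ := b
        obtain rfl : i = j := hab
        -- Conjugation moves the first letter to the end, where it merges with the last.
        have hconj : (of a)⁻¹ * g * (of a)⁻¹⁻¹ = listProd (l ++ [⟨i, b * a⟩]) := by
          simp [hg, mul_assoc]
        have hlt := length_normalForm_listProd_le (l ++ [⟨i, b * a⟩])
        rw [← hconj] at hlt
        have hlt' : (normalForm ((of a)⁻¹ * g * (of a)⁻¹⁻¹)).length < (normalForm g).length := by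
          rw [hl]
          refine lt_of_le_of_lt hlt ?_
          simp
        obtain h | ⟨c, h⟩ := ih _ hlt' _ rfl
        · exact ⟨1, Or.inl ⟨i, 1, by simp [conj_eq_one_iff.1 h]⟩⟩
        · have hc : c * ((of a)⁻¹ * g * (of a)⁻¹⁻¹) * c⁻¹ =
              c * (of a)⁻¹ * g * (c * (of a)⁻¹)⁻¹ := by group
          rw [hc] at h
          exact ⟨_, h⟩
      · exact ⟨1, Or.inr ⟨a, l, b, by simpa using hl, hab⟩⟩

end Monoid.CoprodI

/-! ### Infinite words and stabilizers of their ends -/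

namespace Monoid.CoprodI

section RayStabilizer

variable {Γ : Type*} [Group Γ]

/-- Right multiplication by `x` shifts the sequence `p` by `d` from some index on. -/
def IsShift (p : ℕ → Γ) (x : Γ) (d : ℤ) : Prop :=
  ∃ a b : ℕ, (b : ℤ) - a = d ∧ ∀ k, p (a + k) * x = p (b + k)

theorem IsShift.mul {p : ℕ → Γ} {x y : Γ} {d e : ℤ} (hx : IsShift p x d) (hy : IsShift p y e) :
    IsShift p (x * y) (d + e) := by
  obtain ⟨a, b, hd, hab⟩ := hx
  obtain ⟨a', b', he, hab'⟩ := hy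
  refine ⟨a + a', b + b', by push_cast; omega, fun k => ?_⟩
  rw [← mul_assoc, add_assoc, hab, show b + (a' + k) = a' + (b + k) by ring, hab']
  congr 1
  ring

theorem IsShift.inv {p : ℕ → Γ} {x : Γ} {d : ℤ} (hx : IsShift p x d) : IsShift p x⁻¹ (-d) := by
  obtain ⟨a, b, hd, hab⟩ := hx
  exact ⟨b, a, by omega, fun k => by rw [← hab, mul_inv_cancel_right]⟩

theorem isShift_one (p : ℕ → Γ) : IsShift p 1 0 := ⟨0, 0, by simp, by simp⟩

theorem IsShift.unique {p : ℕ → Γ} (hp : Function.Injective p) {x : Γ} {d e : ℤ}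
    (hx : IsShift p x d) (hx' : IsShift p x e) : d = e := by
  obtain ⟨a, b, hd, hab⟩ := hx
  obtain ⟨a', b', he, hab'⟩ := hx'
  have h1 := hab a'
  rw [add_comm a a', hab' a] at h1
  have := hp h1
  omega

/-- A zero shift fixes a point of the sequence, and right multiplication acts freely. -/
theorem IsShift.eq_one {p : ℕ → Γ} {x : Γ} (hx : IsShift p x 0) : x = 1 := by
  obtain ⟨a, b, hd, hab⟩ := hx
  obtain rfl : a = b := by omega
  exact mul_eq_left.1 (hab 0)

/-- The stabilizer of the end of the sequence `p`. -/
def endStabilizer (p : ℕ → Γ) : Subgroup Γ where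
  carrier := {x | ∃ d, IsShift p x d}
  one_mem' := ⟨0, isShift_one p⟩
  mul_mem' := fun ⟨d, hd⟩ ⟨e, he⟩ => ⟨d + e, hd.mul he⟩
  inv_mem' := fun ⟨d, hd⟩ => ⟨-d, hd.inv⟩

/-- The length by which an element of the stabilizer of the end of `p` shifts `p`. -/
noncomputable def shiftHom {p : ℕ → Γ} (hp : Function.Injective p) :
    endStabilizer p →* Multiplicative ℤ :=
  MonoidHom.mk' (fun x => .ofAdd x.2.choose) fun x y => by
    rw [← ofAdd_add]
    congr 1
    exact (x * y).2.choose_spec.unique hp (x.2.choose_spec.mul y.2.choose_spec)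

theorem shiftHom_injective {p : ℕ → Γ} (hp : Function.Injective p) :
    Function.Injective (shiftHom hp) := by
  rw [injective_iff_map_eq_one]
  intro x hx
  have h0 : x.2.choose = 0 := by simpa [shiftHom] using hx
  have := x.2.choose_spec
  rw [h0] at this
  exact Subtype.ext this.eq_one

end RayStabilizer

variable {ι : Type*} {G : ι → Type*} [∀ i, Group (G i)]

/-- The partial products of an infinite word, written from right to left. -/
def ray (s : ℕ → Σ i, G i) : ℕ → CoprodI G
  | 0 => 1
  | n + 1 => of (s n).2 * ray s n

/-- An infinite reduced word. -/
def IsReducedSeq (s : ℕ → Σ i, G i) : Prop :=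
  ∀ n, (s n).2 ≠ 1 ∧ (s (n + 1)).1 ≠ (s n).1

variable {s : ℕ → Σ i, G i}

theorem IsReducedSeq.normalForm_ray_mul (hs : IsReducedSeq s) {x : CoprodI G} {a : ℕ}
    (ha : ∀ b ∈ (normalForm (ray s a * x)).head?, (s a).1 ≠ b.1) (k : ℕ) :
    normalForm (ray s (a + k + 1) * x) = s (a + k) :: normalForm (ray s (a + k) * x) := by
  induction k with
  | zero =>
    rw [add_zero, ray, mul_assoc, normalForm_of_mul (hs a).1 ha]
  | succ k ih =>
    rw [ray, mul_assoc, normalForm_of_mul (hs _).1]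
    rw [← add_assoc, ih]
    simp only [List.head?_cons, Option.mem_some_iff]
    rintro _ rfl
    exact (hs _).2

theorem IsReducedSeq.normalForm_ray_succ (hs : IsReducedSeq s) (n : ℕ) :
    normalForm (ray s (n + 1)) = s n :: normalForm (ray s n) := by
  have := hs.normalForm_ray_mul (x := 1) (a := 0) (by simp [ray]) n
  simpa using this

theorem IsReducedSeq.length_normalForm_ray (hs : IsReducedSeq s) (n : ℕ) :
    (normalForm (ray s n)).length = n := by
  induction n with
  | zero => simp [ray]
  | succ n ih => rw [hs.normalForm_ray_succ, List.length_cons, ih]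

theorem IsReducedSeq.ray_injective (hs : IsReducedSeq s) : Function.Injective (ray s) := by
  intro m n h
  rw [← hs.length_normalForm_ray m, h, hs.length_normalForm_ray n]

/-- Multiplying a sufficiently long partial product by `x` leaves letters uncancelled. -/
theorem IsReducedSeq.exists_uncancelled (hs : IsReducedSeq s) (x : CoprodI G) :
    ∃ a, ∀ b ∈ (normalForm (ray s a * x)).head?, (s a).1 ≠ b.1 := by
  -- Each further letter either survives, which settles the matter, or cancels and shortens the
  -- word.
  suffices ∀ n j, (normalForm (ray s j * x)).length ≤ n →
      ∃ a, ∀ b ∈ (normalForm (ray s a * x)).head?, (s a).1 ≠ b.1 from this _ 0 le_rfl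
  intro n
  induction n with
  | zero =>
    intro j hj
    refine ⟨j, ?_⟩
    rw [List.length_eq_zero_iff.1 (nonpos_iff_eq_zero.1 hj)]
    simp
  | succ n ih =>
    intro j hj
    obtain h | ⟨m₀, l, hl, h | ⟨m', h⟩⟩ := normalForm_of_mul_cases (hs j).1 (ray s j * x) <;>
      rw [← mul_assoc] at h
    · refine ⟨j + 1, ?_⟩
      rw [ray, h]
      simp only [List.head?_cons, Option.mem_some_iff]
      rintro _ rfl
      exact (hs j).2
    · refine ih (j + 1) ?_
      rw [ray, h]
      rw [hl, List.length_cons] at hj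
      omega
    · refine ⟨j + 1, ?_⟩
      rw [ray, h]
      simp only [List.head?_cons, Option.mem_some_iff]
      rintro _ rfl
      exact (hs j).2

theorem isSuffix_of_cons_succ {α : Type*} {f : ℕ → List α} (h : ∀ n, ∃ a, f (n + 1) = a :: f n)
    {m n : ℕ} (hmn : m ≤ n) : f m <:+ f n := by
  induction n, hmn using Nat.le_induction with
  | base => exact List.suffix_rfl
  | succ n _ ih =>
    obtain ⟨a, ha⟩ := h n
    rw [ha]
    exact ih.trans (List.suffix_cons _ _)

/-- If `x` conjugates a positive power of `ray s L` to a positive power of it, where the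
infinite word `s` has period `L`, then `x` stabilizes the end of the infinite word. -/
theorem IsReducedSeq.mem_endStabilizer (hs : IsReducedSeq s) {L : ℕ} (hL : 0 < L) {z : CoprodI G}
    (hz : ∀ n, ray s (n * L) = z ^ n) {x : CoprodI G} {l m : ℕ} (hl : 0 < l) (hm : 0 < m)
    (hx : z ^ l * x = x * z ^ m) : x ∈ endStabilizer (ray s) := by
  obtain ⟨a, ha⟩ := hs.exists_uncancelled x
  set b := (normalForm (ray s a * x)).length with hb
  refine ⟨(b : ℤ) - a, a, b, rfl, fun k => normalForm_injective ?_⟩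
  have hlen : ∀ k, (normalForm (ray s (a + k) * x)).length = b + k := by
    intro k
    induction k with
    | zero => simp [hb]
    | succ k ih => rw [← add_assoc, hs.normalForm_ray_mul ha, List.length_cons, ih, add_assoc]
  -- `N` is so large that multiplying `z ^ (m * N)` by `x` on the left cannot touch its last `b + k`
  -- letters. Both words to be compared are then suffixes, of equal length, of one word.
  obtain ⟨N, hN1, hN2⟩ : ∃ N, a + k ≤ l * N * L ∧ b + k + (normalForm x).length ≤ m * N * L := by
    refine ⟨a + b + k + (normalForm x).length, ?_, ?_⟩
    · calc a + k ≤ 1 * (a + b + k + (normalForm x).length) * 1 := by omega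
        _ ≤ _ := by gcongr <;> omega
    · calc b + k + (normalForm x).length ≤ 1 * (a + b + k + (normalForm x).length) * 1 := by omega
        _ ≤ _ := by gcongr <;> omega
  have hxN : z ^ (l * N) * x = x * z ^ (m * N) := by
    have : SemiconjBy x (z ^ m) (z ^ l) := hx.symm
    have := this.pow_right N
    rw [← pow_mul, ← pow_mul] at this
    exact this.symm
  rw [← hz, ← hz] at hxN
  have h1 : normalForm (ray s (a + k) * x) <:+ normalForm (ray s (l * N * L) * x) := by
    obtain ⟨c, hc⟩ := Nat.exists_eq_add_of_le ((Nat.le_add_right a k).trans hN1)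
    rw [hc]
    exact isSuffix_of_cons_succ (f := fun n => normalForm (ray s (a + n) * x))
      (fun n => ⟨_, hs.normalForm_ray_mul ha n⟩) (by omega)
  have h2 : normalForm (ray s (b + k)) <:+ normalForm (ray s (l * N * L) * x) := by
    rw [hxN]
    obtain ⟨v, hv⟩ := isSuffix_of_cons_succ (f := fun n => normalForm (ray s n))
      (fun n => ⟨_, hs.normalForm_ray_succ n⟩) (show b + k ≤ m * N * L by omega)
    have hvlen := congrArg List.length hv
    simp only [List.length_append, hs.length_normalForm_ray] at hvlen
    obtain ⟨v', hv', -⟩ := exists_normalForm_mul_eq_append x _ hv.symm (by omega)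
    exact ⟨v', hv'.symm⟩
  have hle : (normalForm (ray s (a + k) * x)).length = (normalForm (ray s (b + k))).length := by
    rw [hlen, hs.length_normalForm_ray]
  exact (List.suffix_of_suffix_length_le h1 h2 hle.le).eq_of_length hle

/-- The powers of a cyclically reduced word are partial products of an infinite reduced word. -/
theorem exists_ray_of_cyclicallyReduced {z : CoprodI G} {a b : Σ i, G i} {l : List (Σ i, G i)}
    (hz : normalForm z = a :: (l ++ [b])) (hab : a.1 ≠ b.1) :
    ∃ (s : ℕ → Σ i, G i) (L : ℕ), IsReducedSeq s ∧ 0 < L ∧ ∀ n, ray s (n * L) = z ^ n := by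
  -- Reversed because `ray` builds words from right to left.
  set r := (normalForm z).reverse with hr
  have hrlen : r.length = l.length + 2 := by simp [hr, hz]
  have hmod : ∀ n, n % r.length < r.length := fun n => Nat.mod_lt _ (by omega)
  let s : ℕ → Σ i, G i := fun n => r[n % r.length]'(hmod n)
  have hchain : r.IsChain fun a b => b.1 ≠ a.1 := by
    rw [hr, List.isChain_reverse]
    exact normalForm_isChain z
  have hr0 : r[0]'(by omega) = b := by simp [hr, hz]
  have hrl : r[l.length + 1]'(by omega) = a := by simp [hr, hz]
  refine ⟨s, r.length, fun n => ⟨?_, ?_⟩, by omega, ?_⟩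
  · refine ne_one_of_mem_normalForm (x := z) ?_
    rw [← List.mem_reverse]
    exact List.getElem_mem _
  · by_cases hn : n % r.length + 1 < r.length
    · have h1 : (n + 1) % r.length = n % r.length + 1 := by
        rw [Nat.add_mod, Nat.mod_eq_of_lt (show 1 < r.length by omega), Nat.mod_eq_of_lt hn]
      simp only [s, h1]
      exact List.isChain_iff_getElem.1 hchain _ hn
    -- The seam between two copies of `z`, where `hab` keeps the word reduced.
    · have h0 : n % r.length = l.length + 1 := by
        have := hmod n
        omega
      have h1 : (n + 1) % r.length = 0 := by
        rw [Nat.add_mod, Nat.mod_eq_of_lt (show 1 < r.length by omega), h0]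
        rw [show l.length + 1 + 1 = r.length by omega, Nat.mod_self]
      simp only [s, h0, h1, hr0, hrl]
      exact hab.symm
  · have htake : ∀ n ≤ r.length, ray s n = listProd (r.take n).reverse := by
      intro n
      induction n with
      | zero => simp [ray]
      | succ n ih =>
        intro hn
        have hsn : s n = r[n]'(by omega) := by
          simp only [s]
          congr 1
          exact Nat.mod_eq_of_lt (by omega)
        rw [ray, ih (by omega), List.take_succ_eq_append_getElem (by omega), List.reverse_append,
          hsn]
        simp only [List.reverse_singleton, List.singleton_append, listProd_cons]
    have hL : ray s r.length = z := by
      rw [htake _ le_rfl, List.take_length, hr, List.reverse_reverse, listProd_normalForm]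
    have hadd : ∀ n, ray s (n + r.length) = ray s n * z := by
      intro n
      induction n with
      | zero => simp [ray, hL]
      | succ n ih =>
        have hsn : s (n + r.length) = s n := by
          simp only [s]
          congr 1
          exact Nat.add_mod_right _ _
        rw [add_right_comm, ray, ih, ray, mul_assoc, hsn]
    intro n
    induction n with
    | zero => simp [ray]
    | succ n ih => rw [add_mul, one_mul, hadd, ih, pow_succ]

end Monoid.CoprodI

/-! ### Transport of nilpotency, maximality and malnormality -/

section NilpotentOfClass

theorem IsNilpotentOfClassLE.of_injective {k : ℕ} {G : Type u} {K : Type v} [Group G] [Group K]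
    {f : K →* G} (hf : Function.Injective f) (h : IsNilpotentOfClassLE k G) :
    IsNilpotentOfClassLE k K := by
  obtain ⟨hG, hk⟩ := h
  have e := MonoidHom.ofInjective hf
  have hK : Group.IsNilpotent K := Group.nilpotent_of_mulEquiv e.symm
  exact ⟨hK, (Group.nilpotencyClass_le_of_surjective e.symm.toMonoidHom e.symm.surjective).trans
    ((Subgroup.nilpotencyClass_le _).trans hk)⟩

theorem IsNilpotentOfClassLE.of_mulEquiv {k : ℕ} {G : Type u} {K : Type v} [Group G] [Group K]
    (e : K ≃* G) (h : IsNilpotentOfClassLE k G) : IsNilpotentOfClassLE k K :=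
  h.of_injective (f := e.toMonoidHom) e.injective

theorem IsNilpotentOfClassLE.map {k : ℕ} {G : Type u} {K : Type v} [Group G] [Group K]
    {f : G →* K} (hf : Function.Injective f) {H : Subgroup G} (h : IsNilpotentOfClassLE k H) :
    IsNilpotentOfClassLE k (H.map f) :=
  h.of_mulEquiv (H.equivMapOfInjective f hf).symm

theorem IsNilpotentOfClassLE.comap {k : ℕ} {G : Type u} {K : Type v} [Group G] [Group K]
    {f : G →* K} (hf : Function.Injective f) {H : Subgroup K} (h : IsNilpotentOfClassLE k H) :
    IsNilpotentOfClassLE k (H.comap f) := by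
  refine h.of_injective (f := f.subgroupComap H) fun x y hxy => Subtype.ext (hf ?_)
  exact congrArg Subtype.val hxy

theorem isNilpotentOfClassLE_of_commute {k : ℕ} (hk : k ≠ 0) {G : Type u} [Group G]
    (h : ∀ x y : G, x * y = y * x) : IsNilpotentOfClassLE k G := by
  let _ : CommGroup G := { mul_comm := h }
  exact ⟨inferInstance, CommGroup.nilpotencyClass_le_one.trans (Nat.one_le_iff_ne_zero.2 hk)⟩

theorem Subgroup.isMalnormal_iff {G : Type u} [Group G] {H : Subgroup G} :
    H.IsMalnormal ↔ ∀ x : G, x ∉ H → ∀ h ∈ H, x⁻¹ * h * x ∈ H → h = 1 := by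
  refine forall₂_congr fun x _ => ?_
  rw [eq_bot_iff]
  constructor
  · intro H' h hh hx
    have := H' ⟨hx, h, hh, by simp⟩
    rw [Subgroup.mem_bot] at this
    calc h = x * (x⁻¹ * h * x) * x⁻¹ := by group
      _ = 1 := by rw [this]; simp
  · rintro H' _ ⟨hx, h, hh, rfl⟩
    have : x⁻¹ * h * x ∈ H := by simpa using hx
    simp [H' h hh this]

/-- Restricting a maximal nilpotent subgroup to a subgroup containing it. -/
theorem Subgroup.IsMaximalNilpotentOfClassLE.comap {k : ℕ} {G : Type u} {K : Type v} [Group G]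
    [Group K] {f : G →* K} (hf : Function.Injective f) {H : Subgroup K}
    (h : H.IsMaximalNilpotentOfClassLE k) (hH : H ≤ f.range) :
    (H.comap f).IsMaximalNilpotentOfClassLE k := by
  refine ⟨h.1.comap hf, fun L hL hHL => ?_⟩
  rw [← Subgroup.map_le_iff_le_comap]
  refine h.2 (IsNilpotentOfClassLE.map hf hL) ?_
  rw [← Subgroup.map_comap_eq_self hH]
  exact Subgroup.map_mono hHL

theorem Subgroup.IsMalnormal.of_comap {G : Type u} {K : Type v} [Group G] [Group K] (e : G ≃* K)
    {H : Subgroup K} (h : (H.comap e.toMonoidHom).IsMalnormal) : H.IsMalnormal := by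
  rw [Subgroup.isMalnormal_iff] at *
  intro x hx g hg hxg
  have := h (e.symm x) (by simpa using hx) (e.symm g) (by simpa using hg) (by simpa using hxg)
  simpa using this

theorem IsCSN.of_mulEquiv {k : ℕ} {G : Type u} {K : Type v} [Group G] [Group K] (e : G ≃* K)
    (h : IsCSN k G) : IsCSN k K := by
  intro H hH
  refine Subgroup.IsMalnormal.of_comap e (h _ (hH.comap e.injective ?_))
  rw [MonoidHom.range_eq_top.2 e.surjective]
  exact le_top

/-- The only maximal such subgroup is the whole group, so no `x` lies outside it. -/
theorem IsNilpotentOfClassLE.isCSN {k : ℕ} {G : Type u} [Group G]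
    (h : IsNilpotentOfClassLE k G) : IsCSN k G := by
  intro H hH x hx
  refine absurd (hH.2 (y := ⊤) ?_ le_top (Subgroup.mem_top x)) hx
  exact h.of_mulEquiv Subgroup.topEquiv

end NilpotentOfClass

/-! ### Malnormality in free products -/

namespace Monoid.CoprodI

section RayStabilizer

variable {Γ : Type*} [Group Γ] {p : ℕ → Γ}

theorem endStabilizer_mul_comm (hp : Function.Injective p) (x y : endStabilizer p) :
    x * y = y * x :=
  shiftHom_injective hp (by rw [map_mul, map_mul, mul_comm])

/-- Any two elements of the stabilizer of an end are commensurable. -/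
theorem zpow_shiftHom_eq (hp : Function.Injective p) (x y : endStabilizer p) :
    x ^ (shiftHom hp y).toAdd = y ^ (shiftHom hp x).toAdd := by
  apply shiftHom_injective hp
  rw [map_zpow, map_zpow]
  apply Multiplicative.toAdd.injective
  rw [toAdd_zpow, toAdd_zpow, smul_eq_mul, smul_eq_mul, mul_comm]

theorem toAdd_shiftHom_eq_zero_iff (hp : Function.Injective p) {x : endStabilizer p} :
    (shiftHom hp x).toAdd = 0 ↔ x = 1 := by
  rw [toAdd_eq_zero, map_eq_one_iff _ (shiftHom_injective hp)]

end RayStabilizer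

variable {ι : Type*} {G : ι → Type*} [∀ i, Group (G i)]

/-- Powers of a cyclically reduced element are distinct partial products of an infinite word, so
torsion is conjugate into a factor. -/
theorem exists_orderOf_eq_two {x : CoprodI G} (hx : orderOf x = 2) :
    ∃ (i : ι) (a : G i), orderOf a = 2 := by
  obtain rfl | ⟨c, ⟨i, a, h⟩ | ⟨a, l, b, h, hab⟩⟩ := exists_conj_of_or_cyclicallyReduced x
  · simp at hx
  · refine ⟨i, a, ?_⟩
    rw [← orderOf_injective (of : G i →* CoprodI G) (of_injective i), ← h, ← hx]
    exact orderOf_injective (MulAut.conj c).toMonoidHom (MulAut.conj c).injective x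
  · exfalso
    obtain ⟨s, L, hs, hL, hz⟩ := exists_ray_of_cyclicallyReduced h hab
    have h2 : (c * x * c⁻¹) ^ 2 = 1 := by
      rw [conj_pow, ← hx, pow_orderOf_eq_one]
      simp
    rw [← hz 2] at h2
    have := hs.ray_injective (h2.trans (show 1 = ray s 0 from rfl))
    omega

theorem IsReducedSeq.mem_endStabilizer_of_zpow {s : ℕ → Σ i, G i} (hs : IsReducedSeq s) {L : ℕ}
    (hL : 0 < L) {z : CoprodI G} (hz : ∀ n, ray s (n * L) = z ^ n) {x : CoprodI G} {l m : ℤ}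
    (hlm : 0 < l * m) (hx : SemiconjBy x (z ^ m) (z ^ l)) : x ∈ endStabilizer (ray s) := by
  wlog hl : 0 < l generalizing l m
  · refine this (l := -l) (m := -m) (by simpa using hlm) ?_ ?_
    · rw [zpow_neg, zpow_neg]
      exact hx.inv_right
    · have : l ≠ 0 := by rintro rfl; simp at hlm
      omega
  have hm : 0 < m := (pos_iff_pos_of_mul_pos hlm).1 hl
  lift l to ℕ using hl.le
  lift m to ℕ using hm.le
  rw [zpow_natCast, zpow_natCast] at hx
  exact hs.mem_endStabilizer hL hz (by omega) (by omega) hx.symm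

/-- A maximal nilpotent subgroup of a free product without elements of order two is malnormal
if it centralizes a cyclically reduced element. -/
theorem isMalnormal_of_cyclicallyReduced {k : ℕ} (h2 : ∀ (i : ι) (a : G i), orderOf a ≠ 2)
    {H : Subgroup (CoprodI G)} (hH : H.IsMaximalNilpotentOfClassLE k) {z : CoprodI G} (hzH : z ∈ H)
    (hcomm : ∀ h ∈ H, z * h = h * z) {a b : Σ i, G i} {l : List (Σ i, G i)}
    (hz : normalForm z = a :: (l ++ [b])) (hab : a.1 ≠ b.1) : H.IsMalnormal := by
  obtain ⟨s, L, hs, hL, hzs⟩ := exists_ray_of_cyclicallyReduced hz hab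
  have hp := hs.ray_injective
  have hz1 : z ≠ 1 := by
    rintro rfl
    simp at hz
  have hk : k ≠ 0 := by
    rintro rfl
    have := hH.1.1
    have hsub := Group.nilpotencyClass_zero_iff_subsingleton.1 (nonpos_iff_eq_zero.1 hH.1.2)
    exact hz1 (congrArg Subtype.val (Subsingleton.elim (⟨z, hzH⟩ : H) 1))
  have hHE : H ≤ endStabilizer (ray s) := fun h hh =>
    hs.mem_endStabilizer hL hzs (l := 1) (m := 1) one_pos one_pos (by simpa using hcomm h hh)
  have hEH : endStabilizer (ray s) ≤ H :=
    hH.2 (isNilpotentOfClassLE_of_commute hk (endStabilizer_mul_comm hp)) hHE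
  have hcoe : ∀ x y : endStabilizer (ray s), (x : CoprodI G) ^ (shiftHom hp y).toAdd =
      (y : CoprodI G) ^ (shiftHom hp x).toAdd := fun x y => by
    simpa using congrArg Subtype.val (zpow_shiftHom_eq hp x y)
  have hne : ∀ x : endStabilizer (ray s), (x : CoprodI G) ≠ 1 → (shiftHom hp x).toAdd ≠ 0 :=
    fun x hx h0 => hx (congrArg Subtype.val ((toAdd_shiftHom_eq_zero_iff hp).1 h0))
  let zE : endStabilizer (ray s) := ⟨z, hHE hzH⟩
  have hζ : (shiftHom hp zE).toAdd ≠ 0 := hne zE hz1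
  rw [Subgroup.isMalnormal_iff]
  intro x hx h hh hxh
  by_contra h1
  let hE : endStabilizer (ray s) := ⟨h, hHE hh⟩
  let hE' : endStabilizer (ray s) := ⟨x⁻¹ * h * x, hHE hxh⟩
  have hβ := hne hE h1
  have hα := hne hE' (by
    intro h'
    apply h1
    calc h = x * (x⁻¹ * h * x) * x⁻¹ := by group
      _ = 1 := by rw [show x⁻¹ * h * x = 1 from h']; simp)
  have hβz := hcoe hE zE
  have hαz := hcoe hE' zE
  set ζ := (shiftHom hp zE).toAdd with hζdef
  set α := (shiftHom hp hE').toAdd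
  set β := (shiftHom hp hE).toAdd
  -- Commensurability in the stabilizer replaces `h` and its conjugate by powers of `z`.
  have hconj : SemiconjBy x (z ^ α) (z ^ β) := by
    rw [show z ^ α = (x⁻¹ * h * x) ^ ζ from hαz.symm, show z ^ β = h ^ ζ from hβz.symm]
    exact SemiconjBy.zpow_right (by simp [SemiconjBy, mul_assoc]) _
  have hneg : β * α < 0 := by
    refine lt_of_le_of_ne (not_lt.1 fun hpos => ?_) (mul_ne_zero hβ hα)
    exact hx (hEH (hs.mem_endStabilizer_of_zpow hL hzs hpos hconj))
  have hpow : ∀ n : ℤ, SemiconjBy x (z ^ (α * n)) (z ^ (β * n)) := by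
    intro n
    rw [zpow_mul, zpow_mul]
    exact hconj.zpow_right n
  -- Conjugating twice turns the exponents into the positive squares `α * α` and `β * β`.
  have hx2 : x ^ 2 ∈ endStabilizer (ray s) := by
    refine hs.mem_endStabilizer_of_zpow hL hzs (l := β * β) (m := α * α) (by nlinarith) ?_
    rw [pow_two]
    refine SemiconjBy.mul_left (y := z ^ (β * α)) ?_ (hpow α)
    rw [mul_comm β α]
    exact hpow β
  let y : endStabilizer (ray s) := ⟨x ^ 2, hx2⟩
  have hyz := hcoe y zE
  rw [← hζdef] at hyz
  set η := (shiftHom hp y).toAdd with hη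
  -- `x` commutes with `x ^ 2`, hence with `z ^ η`. Comparison with `hpow η` gives `α * η = β * η`,
  -- and the opposite signs of `α` and `β` leave only `η = 0`.
  have hcx : SemiconjBy x (z ^ η) (z ^ η) := by
    rw [show z ^ η = (x ^ 2) ^ ζ from hyz.symm]
    exact ((Commute.refl x).pow_right 2).zpow_right ζ
  have hαβ : zE ^ (α * η) = zE ^ (β * η) := by
    apply Subtype.ext
    rw [Subgroup.coe_zpow, Subgroup.coe_zpow]
    have h3 : SemiconjBy x (z ^ (α * η)) (z ^ (α * η)) := by
      rw [mul_comm, zpow_mul]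
      exact hcx.zpow_right α
    exact mul_right_cancel (h3.eq.symm.trans (hpow η).eq)
  have hη0 : η = 0 := by
    have h4 := congrArg (fun t => (shiftHom hp t).toAdd) hαβ
    simp only [map_zpow, toAdd_zpow, smul_eq_mul, ← hζdef] at h4
    have h5 := mul_right_cancel₀ hζ h4
    by_contra h0
    have h6 := mul_right_cancel₀ h0 h5
    rw [h6] at hneg
    nlinarith
  have hx2' : x ^ 2 = 1 := congrArg Subtype.val ((toAdd_shiftHom_eq_zero_iff hp).1 hη0)
  have hx1 : x ≠ 1 := by
    rintro rfl
    exact hx H.one_mem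
  obtain ⟨i, a, ha⟩ := exists_orderOf_eq_two (orderOf_eq_prime hx2' hx1)
  exact h2 i a ha

/-- A maximal nilpotent subgroup of a free product is malnormal if it centralizes a nontrivial
element of a factor which has this property. -/
theorem isMalnormal_of_mem_range {k : ℕ} {i : ι} (hG : IsCSN k (G i)) {H : Subgroup (CoprodI G)}
    (hH : H.IsMaximalNilpotentOfClassLE k) {a : G i} (ha : a ≠ 1)
    (hcomm : ∀ h ∈ H, of a * h = h * of a) : H.IsMalnormal := by
  have hHr : H ≤ (of : G i →* CoprodI G).range := fun h hh =>
    mem_range_of_of_mul_eq ha (hcomm h hh)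
  have hmal := Subgroup.isMalnormal_iff.1 (hG _ (hH.comap (of_injective i) hHr))
  rw [Subgroup.isMalnormal_iff]
  intro x hx h hh hxh
  by_contra h1
  obtain ⟨b, rfl⟩ := hHr hh
  obtain ⟨b', hb'⟩ := hHr hxh
  have hb1 : b ≠ 1 := by
    rintro rfl
    simp at h1
  obtain ⟨y, rfl⟩ := mem_range_of_of_mul_eq hb1 (g := x) (b := b') (by rw [hb']; group)
  exact hb1 (hmal y hx b hh (by simpa using hxh))

/-- A free product of `CSN_k` groups without elements of order two is `CSN_k`. -/
theorem isCSN {k : ℕ} (hG : ∀ i, IsCSN k (G i)) (h2 : ∀ (i : ι) (a : G i), orderOf a ≠ 2) :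
    IsCSN k (CoprodI G) := by
  intro H hH
  obtain rfl | hbot := eq_or_ne H ⊥
  · rw [Subgroup.isMalnormal_iff]
    intro x _ h hh _
    simpa using hh
  have := hH.1.1
  have hnt : Nontrivial H := (Subgroup.nontrivial_iff_ne_bot H).2 hbot
  obtain ⟨z, hz, hz1⟩ := ((Subgroup.center H).bot_or_exists_ne_one).resolve_left
    (Group.IsNilpotent.center_ne_bot H)
  have hcomm : ∀ h ∈ H, (z : CoprodI G) * h = h * z := fun h hh =>
    congrArg Subtype.val (Subgroup.mem_center_iff.1 hz ⟨h, hh⟩).symm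
  have hz1' : (z : CoprodI G) ≠ 1 := fun h => hz1 (Subtype.ext h)
  obtain ⟨c, hc⟩ := (exists_conj_of_or_cyclicallyReduced (z : CoprodI G)).resolve_left hz1'
  refine Subgroup.IsMalnormal.of_comap (MulAut.conj c⁻¹) ?_
  set K := H.comap (MulAut.conj c⁻¹).toMonoidHom
  have hmem : ∀ x, x ∈ K ↔ c⁻¹ * x * c ∈ H := fun x => by simp [K, Subgroup.mem_comap]
  have hK : K.IsMaximalNilpotentOfClassLE k := by
    refine hH.comap (MulAut.conj c⁻¹).injective ?_
    rw [MonoidHom.range_eq_top.2 (MulAut.conj c⁻¹).surjective]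
    exact le_top
  have hzK : c * z * c⁻¹ ∈ K := by simp [hmem, mul_assoc]
  have hcommK : ∀ h ∈ K, c * z * c⁻¹ * h = h * (c * z * c⁻¹) := by
    intro h hh
    calc c * z * c⁻¹ * h = c * (z * (c⁻¹ * h * c)) * c⁻¹ := by group
      _ = c * (c⁻¹ * h * c * z) * c⁻¹ := by rw [hcomm _ ((hmem h).1 hh)]
      _ = h * (c * z * c⁻¹) := by group
  obtain ⟨i, a, h⟩ | ⟨a, l, b, h, hab⟩ := hc
  · rw [h] at hcommK
    refine isMalnormal_of_mem_range (hG i) hK (a := a) ?_ hcommK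
    rintro rfl
    rw [map_one, conj_eq_one_iff] at h
    exact hz1' h
  · exact isMalnormal_of_cyclicallyReduced h2 hK hzK hcommK h hab

end Monoid.CoprodI

/-! ### Binary free products and the conclusion -/

/-- The family of two groups `A` and `B`, indexed by `Bool`. -/
abbrev BoolFamily (A : Type u) (B : Type v) : Bool → Type max u v
  | true => ULift.{v} A
  | false => ULift.{u} B

instance BoolFamily.instGroup (A : Type u) (B : Type v) [Group A] [Group B] :
    ∀ b, Group (BoolFamily A B b)
  | true => inferInstanceAs (Group (ULift.{v} A))
  | false => inferInstanceAs (Group (ULift.{u} B))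

/-- The free product of the family of `A` and `B` is the binary free product. -/
def Monoid.CoprodI.boolFamilyEquiv (A : Type u) (B : Type v) [Group A] [Group B] :
    Monoid.CoprodI (BoolFamily A B) ≃* Monoid.Coprod A B :=
  MonoidHom.toMulEquiv
    (Monoid.CoprodI.lift fun
      | true => Monoid.Coprod.inl.comp (MulEquiv.ulift (α := A)).toMonoidHom
      | false => Monoid.Coprod.inr.comp (MulEquiv.ulift (α := B)).toMonoidHom)
    (Monoid.Coprod.lift
      ((Monoid.CoprodI.of (M := BoolFamily A B) (i := true)).comp MulEquiv.ulift.symm.toMonoidHom)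
      ((Monoid.CoprodI.of (M := BoolFamily A B) (i := false)).comp MulEquiv.ulift.symm.toMonoidHom))
    (by
      refine Monoid.CoprodI.ext_hom _ _ fun b => ?_
      cases b <;> ext x <;> simp)
    (by
      ext x <;> simp)

theorem FreeNilpotentGroup.isNilpotentOfClassLE (k : ℕ) (X : Type u) :
    IsNilpotentOfClassLE k (FreeNilpotentGroup k X) := by
  have h : (⊤ : Subgroup (FreeNilpotentGroup k X)).lowerCentralSeries k = ⊥ := by
    rw [← Subgroup.map_top_of_surjective _ (QuotientGroup.mk'_surjective
      ((⊤ : Subgroup (FreeGroup X)).lowerCentralSeries k)), ← Subgroup.map_lowerCentralSeries,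
      Subgroup.map_eq_bot_iff, QuotientGroup.ker_mk']
  have hn : Group.IsNilpotent (FreeNilpotentGroup k X) :=
    Subgroup.nilpotent_iff_lowerCentralSeries.2 ⟨k, h⟩
  exact ⟨hn, Subgroup.lowerCentralSeries_eq_bot_iff_nilpotencyClass_le.1 h⟩

theorem mainTheorem4 (k : ℕ) :
    (∀ (A : Type u) (B : Type v) [Group A] [Group B],
      IsCSN k A → IsCSN k B →
      (∀ a : A, orderOf a ≠ 2) → (∀ b : B, orderOf b ≠ 2) →
      IsCSN k (Monoid.Coprod A B)) ∧
    (∀ (A : Type u) (G : Type v) [Group A] [Group G],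
      Group.FG A → IsFreeNilpotent.{u, w} k A →
      IsFreeProductOfCopies.{u, v, x} A G →
      IsCSN k G) := by
  constructor
  · intro A B _ _ hA hB hA2 hB2
    refine IsCSN.of_mulEquiv (Monoid.CoprodI.boolFamilyEquiv A B) (Monoid.CoprodI.isCSN ?_ ?_)
    · rintro (_ | _)
      · exact hB.of_mulEquiv (MulEquiv.ulift (α := B)).symm
      · exact hA.of_mulEquiv (MulEquiv.ulift (α := A)).symm
    · rintro (_ | _) a
      · rw [← MulEquiv.orderOf_eq (MulEquiv.ulift (α := B)) a]
        exact hB2 _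
      · rw [← MulEquiv.orderOf_eq (MulEquiv.ulift (α := A)) a]
        exact hA2 _
  · rintro A G _ _ - ⟨X, ⟨e⟩⟩ ⟨ι, -, ⟨f⟩⟩
    refine IsCSN.of_mulEquiv f.symm (Monoid.CoprodI.isCSN (fun _ => ?_) fun _ a => ?_)
    · exact ((FreeNilpotentGroup.isNilpotentOfClassLE k X).of_mulEquiv e).isCSN
    · rw [← MulEquiv.orderOf_eq e a]
      exact FreeNilpotentGroup.orderOf_ne_two _
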